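/- **Theorem 2.3.** Let $0<q<1$ and let $\alpha,\beta,\gamma\in\mathbb R$ satisfy $0<\alpha q<1$, $0\le\beta q<1$ and $\gamma<0$. Write $(a;q)_i=\prod_{j=0}^{i-1}(1-aq^j)$ for $i\in\mathbb N_0\cup\{\infty\}$ and $(a_1,\dots,a_r;q)_i=(a_1;q)_i\cdots(a_r;q)_i$. For real parameters $a,b,c$ the big $q$-Jacobi polynomials are $$\tilde P_n(x;a,b,c;q)=\frac{(aq,cq;q)_n}{(abq^{n+1};q)_n}\sum_{i=0}^{n}\frac{(q^{-n},abq^{n+1},x;q)_i}{(aq,cq;q)_i}\,\frac{q^i}{(q;q)_i}.$$ Let $$w(x)=\frac{(\alpha^{-1}x,\gamma^{-1}x;q)_\infty}{(x,\beta\gamma^{-1}x;q)_\infty},$$ and let $\int_{\gamma q}^{\alpha q} f(x)\,d_qx=(1-q)\,\alpha q\sum_{j\ge0}f(\alpha q^{j+1})q^j-(1-q)\,\gamma q\sum_{j\ge0}f(\gamma q^{j+1})q^j$ be the Jackson $q$-integral. For integers $0\le r\le n-1$, a polynomial $Q$ of exact degree $n$ is called *quasi-orthogonal of order $r$* with respect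 to $w$ on $(\gamma q,\alpha q)$ if $w>0$ on $[\gamma q,\alpha q]$, all the $q$-integrals $\int_{\gamma q}^{\alpha q}x^jQ(x)w(x)\,d_qx$, $j\in\mathbb N_0$, converge absolutely, and $$\int_{\gamma q}^{\alpha q}x^jQ(x)w(x)\,d_qx\ \begin{cases}=0,& j\in\{0,1,\dots,n-r-1\},\\ \ne0,& j=n-r.\end{cases}$$ Then for all $k,l,m,n\in\mathbb N_0$: 1. if $\alpha>1$ and $k\le n-1$, then $\tilde P_n\big(x;\tfrac{\alpha}{q^k},\beta,\gamma;q\big)$ is quasi-orthogonal of order $k$ with respect to $w$ on $(\gamma q,\alpha q)$ and has at least $n-k$ distinct real zeros in $(\gamma q,\alpha q)$; 2. if $\beta>1$ and $m\le n-1$, then $\tilde P_n\big(x;\alpha,\tfrac{\beta}{q^m},\gamma;q\big)$ is quasi-orthogonal of order $m$ with respect to $w$ on $(\gamma q,\alpha q)$ and has at least $n-m$ distinct real zeros in $(\gamma q,\alpha q)$; 3. if $\beta>1$ and $l\le n-1$, then $\tilde P_n\big(x;\alpha,\tfrac{\beta}{q^l},\tfrac{\gamma}{q^l};q\big)$ is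 quasi-orthogonal of order $l$ with respect to $w$ on $(\gamma q,\alpha q)$ and has at least $n-l$ distinct real zeros in $(\gamma q,\alpha q)$; 4. if $\alpha>1$, $\beta>1$ and $k+m\le n-1$, then $\tilde P_n\big(x;\tfrac{\alpha}{q^k},\tfrac{\beta}{q^m},\gamma;q\big)$ is quasi-orthogonal of order $k+m$ with respect to $w$ on $(\gamma q,\alpha q)$ and has at least $n-(k+m)$ distinct real zeros in $(\gamma q,\alpha q)$. -/

import Mathlib

open Polynomial

/-- The finite `q`-Pochhammer symbol `(a; q)_n = ∏_{j < n} (1 - a q^j)`, over any commutative ring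
(below: over `ℝ`, and over `ℝ[X]` for the polynomial `(x; q)_n` in the variable `x`). -/
def qPoch {R : Type*} [CommRing R] (q a : R) (n : ℕ) : R :=
  ∏ j ∈ Finset.range n, (1 - a * q ^ j)

/-- The infinite `q`-Pochhammer symbol `(a; q)_∞ = ∏_{j ≥ 0} (1 - a q^j)`
(the product converges when `|q| < 1`). -/
noncomputable def qPochInf (q a : ℝ) : ℝ :=
  ∏' j : ℕ, (1 - a * q ^ j)

/-- The basic hypergeometric series `₃φ₂(a₁, a₂, a₃; b₁, b₂; q; z)`. -/
noncomputable def basicHyp32 (q a₁ a₂ a₃ b₁ b₂ z : ℝ) : ℝ :=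
  ∑' i : ℕ, qPoch q a₁ i * qPoch q a₂ i * qPoch q a₃ i / (qPoch q b₁ i * qPoch q b₂ i)
    * (z ^ i / qPoch q q i)

/-- The big `q`-Jacobi polynomial `P̃_n(x; α, β, γ; q)`, i.e.
`(αq;q)_n (γq;q)_n / (αβq^{n+1};q)_n · ₃φ₂(q^{-n}, αβq^{n+1}, x; αq, γq; q; q)`, as a polynomial
in `x`. The series terminates at the index `n`, since `(q^{-n};q)_i = 0` for `i > n`;
see `bigQJacobi_eval`. -/
noncomputable def bigQJacobi (q α β γ : ℝ) (n : ℕ) : ℝ[X] :=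
  C (qPoch q (α * q) n * qPoch q (γ * q) n / qPoch q (α * β * q ^ (n + 1)) n) *
    ∑ i ∈ Finset.range (n + 1),
      C (qPoch q ((q ^ n)⁻¹) i * qPoch q (α * β * q ^ (n + 1)) i
          / (qPoch q (α * q) i * qPoch q (γ * q) i) * (q ^ i / qPoch q q i))
        * qPoch (C q) X i

theorem qPoch_eval (q x : ℝ) (i : ℕ) : (qPoch (C q) X i).eval x = qPoch q x i := by
  simp [qPoch, eval_prod]

/-- The values of the polynomial `bigQJacobi` are given by the `₃φ₂` series. -/
theorem bigQJacobi_eval (q α β γ : ℝ) (hq : q ≠ 0) (n : ℕ) (x : ℝ) :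
    (bigQJacobi q α β γ n).eval x =
      qPoch q (α * q) n * qPoch q (γ * q) n / qPoch q (α * β * q ^ (n + 1)) n *
        basicHyp32 q ((q ^ n)⁻¹) (α * β * q ^ (n + 1)) x (α * q) (γ * q) q := by
  rw [basicHyp32, tsum_eq_sum (s := Finset.range (n + 1))]
  · simp only [bigQJacobi, eval_mul, eval_C, eval_finsetSum, qPoch_eval]
    congr 1
    refine Finset.sum_congr rfl fun i _ => ?_
    ring
  · intro i hi
    have h0 : qPoch q ((q ^ n)⁻¹) i = 0 := by
      refine Finset.prod_eq_zero (i := n) ?_ ?_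
      · simp only [Finset.mem_range] at hi ⊢
        omega
      · rw [inv_mul_cancel₀ (pow_ne_zero n hq), sub_self]
    simp [h0]

/-- The weight `w(x) = (x/α, x/γ; q)_∞ / (x, βx/γ; q)_∞` of the big `q`-Jacobi polynomials. -/
noncomputable def bigQJacobiWeight (q α β γ x : ℝ) : ℝ :=
  qPochInf q (α⁻¹ * x) * qPochInf q (γ⁻¹ * x) / (qPochInf q x * qPochInf q (β * γ⁻¹ * x))

/-- The `q`-integral `∫_a^b f(x) d_q x` converges: the two series defining it are summable. -/
def QIntegrable (q a b : ℝ) (f : ℝ → ℝ) : Prop :=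
  Summable (fun j : ℕ => f (a * q ^ j) * q ^ j) ∧ Summable (fun j : ℕ => f (b * q ^ j) * q ^ j)

/-- The (Jackson) `q`-integral
`∫_a^b f(x) d_q x = b(1-q) ∑_{j ≥ 0} f(b q^j) q^j - a(1-q) ∑_{j ≥ 0} f(a q^j) q^j`. -/
noncomputable def qIntegral (q a b : ℝ) (f : ℝ → ℝ) : ℝ :=
  b * (1 - q) * ∑' j : ℕ, f (b * q ^ j) * q ^ j - a * (1 - q) * ∑' j : ℕ, f (a * q ^ j) * q ^ j

/-- `Q`, a polynomial of exact degree `n`, is quasi-orthogonal of order `k ≤ n - 1` on `(a, b)`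
with respect to the weight `w > 0` and the `q`-integral: `∫_a^b x^m Q(x) w(x) d_q x` is zero for
`m = 0, …, n-k-1`, and is not zero for `m = n-k` (so that the order is exactly `k`). -/
structure IsQuasiOrthogonal (q a b : ℝ) (w : ℝ → ℝ) (Q : ℝ[X]) (n k : ℕ) : Prop where
  weight_pos : ∀ x ∈ Set.Icc a b, 0 < w x
  order_lt : k < n
  natDegree_eq : Q.natDegree = n
  integrable : ∀ m : ℕ, QIntegrable q a b (fun x => x ^ m * Q.eval x * w x)
  integral_eq_zero : ∀ m : ℕ, m < n - k → qIntegral q a b (fun x => x ^ m * Q.eval x * w x) = 0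
  integral_ne_zero : qIntegral q a b (fun x => x ^ (n - k) * Q.eval x * w x) ≠ 0

/-- `Q` has at least `r` distinct real zeros in the open interval `(a, b)`. -/
def HasAtLeastZeros (Q : ℝ[X]) (r : ℕ) (a b : ℝ) : Prop :=
  ∃ s : Finset ℝ, r ≤ s.card ∧ ∀ x ∈ s, x ∈ Set.Ioo a b ∧ Q.IsRoot x

open Filter Topology

/-! Let `L p` be the `q`-integral of `p w`. For the unshifted parameters the polynomials are
eigenfunctions of a second-order `q`-difference operator with distinct eigenvalues
(`bigQJacobi_qDifference`). Combined with the Pearson equation of `w`, this turns the eigenvalue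
difference times `P_m P_n w` into a total `q`-difference. Both halves of the `q`-integral telescope
to the same value at `0`, so they cancel, and the `P_n` are orthogonal (`functional_mul_eq_zero`).

Dividing a parameter by `q` is governed by contiguous relations `P_{n+1}(a) = P_{n+1}(aq) + K
P_n(aq)`, and likewise in `b`, with `K ≠ 0`. If both polynomials on the right have order `r`, the
left side has order exactly `r + 1`: at the critical power `x^{n-r}` the first term still integrates
to zero and the second does not (`IsQuasiOrthogonalFor.add_C_mul`). Induction on the number of
shifts gives the orders. The simultaneous shift of `β` and `γ` becomes a shift of the first
parameter alone, because the polynomial depends only on `ab` and the unordered pair `{a, c}`.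

For the zeros, multiply `Q` by the linear factors at its sign changes in the interval. The product
has constant sign there, so positivity of `L` makes its integral nonzero; with fewer than `n - r`
sign changes quasi-orthogonality would make it zero. -/

theorem qPoch_zero {R : Type*} [CommRing R] (q a : R) : qPoch q a 0 = 1 := by simp [qPoch]

theorem qPoch_succ {R : Type*} [CommRing R] (q a : R) (n : ℕ) :
    qPoch q a (n + 1) = qPoch q a n * (1 - a * q ^ n) := by
  simp [qPoch, Finset.prod_range_succ]

theorem qPoch_succ' {R : Type*} [CommRing R] (q a : R) (n : ℕ) :
    qPoch q a (n + 1) = (1 - a) * qPoch q (a * q) n := by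
  rw [qPoch, Finset.prod_range_succ', mul_comm, pow_zero, mul_one, qPoch]
  congr 1
  exact Finset.prod_congr rfl fun j _ => by ring

theorem qPoch_mul_last {R : Type*} [CommRing R] (q a : R) (n : ℕ) :
    qPoch q a n * (1 - a * q ^ n) = (1 - a) * qPoch q (a * q) n := by
  rw [← qPoch_succ, qPoch_succ']

theorem qPoch_ne_zero {q a : ℝ} {n : ℕ} (h : ∀ j < n, 1 - a * q ^ j ≠ 0) : qPoch q a n ≠ 0 :=
  Finset.prod_ne_zero_iff.2 fun j hj => h j (Finset.mem_range.1 hj)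

/-! ### Contiguous relations -/

/-- The coefficient of `(x; q)_i` in the big `q`-Jacobi polynomial of degree `n`. -/
noncomputable def bigQJacobiCoeff (q a b c : ℝ) (n i : ℕ) : ℝ :=
  qPoch q (a * q) n * qPoch q (c * q) n / qPoch q (a * b * q ^ (n + 1)) n *
    (qPoch q ((q ^ n)⁻¹) i * qPoch q (a * b * q ^ (n + 1)) i
      / (qPoch q (a * q) i * qPoch q (c * q) i) * (q ^ i / qPoch q q i))

theorem bigQJacobi_eq_sum (q a b c : ℝ) (n : ℕ) :
    bigQJacobi q a b c n =
      ∑ i ∈ Finset.range (n + 1), C (bigQJacobiCoeff q a b c n i) * qPoch (C q) X i := by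
  simp only [bigQJacobi, Finset.mul_sum, bigQJacobiCoeff, C_mul, mul_assoc]

theorem one_sub_pow_ne_zero {q : ℝ} (hq0 : 0 < q) (hq1 : q < 1) (n : ℕ) :
    1 - q ^ (n + 1) ≠ 0 :=
  (sub_pos.2 (pow_lt_one₀ hq0.le hq1 n.succ_ne_zero)).ne'

theorem qPoch_self_ne_zero {q : ℝ} (hq0 : 0 < q) (hq1 : q < 1) (n : ℕ) : qPoch q q n ≠ 0 :=
  qPoch_ne_zero fun j _ => by
    rw [← pow_succ']; exact one_sub_pow_ne_zero hq0 hq1 j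

theorem qPoch_inv_pow_ne_zero {q : ℝ} (hq0 : 0 < q) (hq1 : q < 1) {n i : ℕ} (hi : i ≤ n) :
    qPoch q ((q ^ n)⁻¹) i ≠ 0 :=
  qPoch_ne_zero fun j hj h => by
    have hqn : q ^ n ≠ 0 := (pow_pos hq0 n).ne'
    have : q ^ n = q ^ j := by
      field_simp at h
      linarith
    exact (pow_lt_pow_right_of_lt_one₀ hq0 hq1 (hj.trans_le hi)).ne this

theorem bigQJacobiCoeff_succ {q a b c : ℝ} (hq0 : 0 < q) (hq1 : q < 1) {n i : ℕ}
    (ha : ∀ j, 1 - a * q ^ (j + 1) ≠ 0) (hc : ∀ j, 1 - c * q ^ (j + 1) ≠ 0) :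
    bigQJacobiCoeff q a b c n (i + 1) *
        ((1 - a * q ^ (i + 1)) * (1 - c * q ^ (i + 1)) * (1 - q ^ (i + 1))) =
      bigQJacobiCoeff q a b c n i *
        ((1 - (q ^ n)⁻¹ * q ^ i) * (1 - a * b * q ^ (n + 1) * q ^ i) * q) := by
  have h3 := one_sub_pow_ne_zero hq0 hq1 i
  have h4 : ∀ k, qPoch q (a * q) k ≠ 0 := fun k => qPoch_ne_zero fun j _ => by
    convert ha j using 2; ring
  have h5 : ∀ k, qPoch q (c * q) k ≠ 0 := fun k => qPoch_ne_zero fun j _ => by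
    convert hc j using 2; ring
  have h6 := qPoch_self_ne_zero hq0 hq1
  -- Linear factors become quotients of consecutive symbols, so that all denominators are atoms
  -- known to be nonzero.
  have e1 : 1 - a * q ^ (i + 1) = qPoch q (a * q) (i + 1) / qPoch q (a * q) i := by
    rw [eq_div_iff (h4 i), qPoch_succ]; ring
  have e2 : 1 - c * q ^ (i + 1) = qPoch q (c * q) (i + 1) / qPoch q (c * q) i := by
    rw [eq_div_iff (h5 i), qPoch_succ]; ring
  have e3 : 1 - q ^ (i + 1) = qPoch q q (i + 1) / qPoch q q i := by
    rw [eq_div_iff (h6 i), qPoch_succ]; ring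
  rw [e1, e2, e3, bigQJacobiCoeff, bigQJacobiCoeff, qPoch_succ q ((q ^ n)⁻¹),
    qPoch_succ q (a * b * q ^ (n + 1))]
  have a1 := h4 i
  have a2 := h4 (i + 1)
  have a3 := h5 i
  have a4 := h5 (i + 1)
  have a5 := h6 i
  have a6 := h6 (i + 1)
  generalize qPoch q (a * q) (i + 1) = A' at *
  generalize qPoch q (c * q) (i + 1) = B' at *
  generalize qPoch q q (i + 1) = E' at *
  generalize 1 - (q ^ n)⁻¹ * q ^ i = u
  field_simp
  ring

/-- At `i = n` the normalising prefactor cancels, leaving a value independent of `a, b, c`. Hence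
top coefficients agree in the contiguous relations. -/
theorem bigQJacobiCoeff_self {q a b c : ℝ} {n : ℕ}
    (ha : ∀ j, 1 - a * q ^ (j + 1) ≠ 0) (hc : ∀ j, 1 - c * q ^ (j + 1) ≠ 0)
    (hab : ∀ j, 1 - a * b * q ^ (n + 1 + j) ≠ 0) :
    bigQJacobiCoeff q a b c n n = qPoch q ((q ^ n)⁻¹) n * (q ^ n / qPoch q q n) := by
  have h4 : qPoch q (a * q) n ≠ 0 := qPoch_ne_zero fun j _ => by
    convert ha j using 2; ring
  have h5 : qPoch q (c * q) n ≠ 0 := qPoch_ne_zero fun j _ => by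
    convert hc j using 2; ring
  have h6 : qPoch q (a * b * q ^ (n + 1)) n ≠ 0 := qPoch_ne_zero fun j _ => by
    convert hab j using 2; ring
  unfold bigQJacobiCoeff
  generalize qPoch q (a * q) n = A at *
  generalize qPoch q (c * q) n = B at *
  generalize qPoch q (a * b * q ^ (n + 1)) n = D at *
  field_simp

theorem bigQJacobiCoeff_ne_zero {q a b c : ℝ} (hq0 : 0 < q) (hq1 : q < 1) {n : ℕ}
    (ha : ∀ j, 1 - a * q ^ (j + 1) ≠ 0) (hc : ∀ j, 1 - c * q ^ (j + 1) ≠ 0)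
    (hab : ∀ j, 1 - a * b * q ^ (n + 1 + j) ≠ 0) :
    bigQJacobiCoeff q a b c n n ≠ 0 := by
  rw [bigQJacobiCoeff_self ha hc hab]
  exact mul_ne_zero (qPoch_inv_pow_ne_zero hq0 hq1 le_rfl)
    (div_ne_zero (pow_pos hq0 n).ne' (qPoch_self_ne_zero hq0 hq1 n))

theorem qPoch_X_degree {q : ℝ} (hq : q ≠ 0) (i : ℕ) :
    (qPoch (C q) X i : ℝ[X]).degree = i := by
  induction i with
  | zero => simp [qPoch_zero]
  | succ i ih =>
    have h : (1 - X * C q ^ i : ℝ[X]) = C (-q ^ i) * X + C 1 := by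
      simp only [C_neg, C_pow, C_1]; ring
    rw [qPoch_succ, degree_mul, ih, h, degree_linear (neg_ne_zero.2 (pow_ne_zero i hq))]
    rfl

theorem bigQJacobi_degree {q a b c : ℝ} (hq0 : 0 < q) (hq1 : q < 1) {n : ℕ}
    (ha : ∀ j, 1 - a * q ^ (j + 1) ≠ 0) (hc : ∀ j, 1 - c * q ^ (j + 1) ≠ 0)
    (hab : ∀ j, 1 - a * b * q ^ (n + 1 + j) ≠ 0) :
    (bigQJacobi q a b c n).degree = n := by
  have hd (i : ℕ) : (C (bigQJacobiCoeff q a b c n i) * qPoch (C q) X i).degree ≤ i := by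
    refine (degree_mul_le _ _).trans ?_
    rw [qPoch_X_degree hq0.ne']
    exact (add_le_add_left degree_C_le _).trans_eq (zero_add _)
  have htop : (C (bigQJacobiCoeff q a b c n n) * qPoch (C q) X n).degree = n := by
    rw [degree_C_mul (bigQJacobiCoeff_ne_zero hq0 hq1 ha hc hab), qPoch_X_degree hq0.ne']
  rw [bigQJacobi_eq_sum, Finset.sum_range_succ, degree_add_eq_right_of_degree_lt, htop]
  rw [htop]
  refine (degree_sum_le _ _).trans_lt ((Finset.sup_lt_iff (by exact WithBot.bot_lt_coe n)).2 ?_)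
  intro i hi
  exact (hd i).trans_lt (by exact_mod_cast Finset.mem_range.1 hi)

/-- A relation `P_{n+1} = Q_{n+1} + K P_n` between polynomials can be checked on the coefficients
with respect to `(x; q)_i`. -/
theorem sum_qPoch_contiguous {q K : ℝ} {n : ℕ} {u v w : ℕ → ℝ}
    (h : ∀ i ≤ n, u i = v i + K * w i) (htop : u (n + 1) = v (n + 1)) :
    (∑ i ∈ Finset.range (n + 1 + 1), C (u i) * qPoch (C q) X i : ℝ[X]) =
      ∑ i ∈ Finset.range (n + 1 + 1), C (v i) * qPoch (C q) X i +
        C K * ∑ i ∈ Finset.range (n + 1), C (w i) * qPoch (C q) X i := by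
  rw [Finset.sum_range_succ, Finset.sum_range_succ _ (n + 1), htop, Finset.mul_sum,
    add_right_comm, ← Finset.sum_add_distrib]
  congr 1
  refine Finset.sum_congr rfl fun i hi => ?_
  rw [h i (Nat.lt_succ_iff.1 (Finset.mem_range.1 hi)), C_add, C_mul]
  ring

theorem qPoch_inv_pow_succ {q : ℝ} (hq : q ≠ 0) (n i : ℕ) :
    qPoch q ((q ^ (n + 1))⁻¹) i * (q ^ (n + 1) - q ^ i) =
      (q ^ (n + 1) - 1) * qPoch q ((q ^ n)⁻¹) i := by
  have h := qPoch_mul_last q ((q ^ (n + 1))⁻¹) i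
  have h1 : (q ^ (n + 1))⁻¹ * q = (q ^ n)⁻¹ := by
    rw [pow_succ]; field_simp
  rw [h1] at h
  have h2 : q ^ (n + 1) ≠ 0 := pow_ne_zero _ hq
  calc _ = q ^ (n + 1) * (qPoch q ((q ^ (n + 1))⁻¹) i * (1 - (q ^ (n + 1))⁻¹ * q ^ i)) := by
        field_simp
    _ = _ := by
        rw [h]; field_simp

theorem pow_sub_pow_ne_zero {q : ℝ} (hq0 : 0 < q) (hq1 : q < 1) {n i : ℕ} (hi : i ≤ n) :
    q ^ (n + 1) - q ^ i ≠ 0 :=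
  (sub_neg.2 (pow_lt_pow_right_of_lt_one₀ hq0 hq1 (Nat.lt_succ_of_le hi))).ne

theorem qPoch_mul_self {q a : ℝ} (ha : 1 - a ≠ 0) (k : ℕ) :
    qPoch q (a * q) k = qPoch q a k * (1 - a * q ^ k) / (1 - a) := by
  rw [eq_div_iff ha, qPoch_mul_last, mul_comm]

/-- Compare coefficients of `(x; q)_i`: once the common Pochhammer symbols cancel, a rational
identity in powers of `q` remains for `i ≤ n`, and the top coefficients coincide. -/
theorem bigQJacobi_contiguous_a {q a b c : ℝ} (hq0 : 0 < q) (hq1 : q < 1) {n : ℕ}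
    (ha : ∀ j, 1 - a * q ^ (j + 1) ≠ 0) (hc : ∀ j, 1 - c * q ^ (j + 1) ≠ 0)
    (hab : ∀ j, 1 - a * b * q ^ (n + 2 + j) ≠ 0) :
    bigQJacobi q a b c (n + 1) = bigQJacobi q (a * q) b c (n + 1) +
      C (-(a * q * (1 - q ^ (n + 1)) * (1 - b * q ^ (n + 1)) * (1 - c * q ^ (n + 1)) /
        ((1 - a * b * q ^ (n + 2 + n)) * (1 - a * b * q ^ (n + 2 + (n + 1)))))) *
        bigQJacobi q (a * q) b c n := by
  simp only [bigQJacobi_eq_sum]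
  have nA (k : ℕ) : qPoch q (a * q) k ≠ 0 := qPoch_ne_zero fun j _ => by
    convert ha j using 2; ring
  have nC (k : ℕ) : qPoch q (c * q) k ≠ 0 := qPoch_ne_zero fun j _ => by
    convert hc j using 2; ring
  have nD (k : ℕ) : qPoch q (a * b * q ^ (n + 2)) k ≠ 0 := qPoch_ne_zero fun j _ => by
    convert hab j using 2; ring
  -- The linear factors are made opaque, so that clearing denominators treats them as atoms; they
  -- are unfolded only for the final polynomial identity.
  obtain ⟨x, hx⟩ : ∃ x : ℕ → ℝ, ∀ k, 1 - a * q ^ (k + 1) = x k := ⟨_, fun _ => rfl⟩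
  obtain ⟨y, hy⟩ : ∃ y : ℕ → ℝ, ∀ k, 1 - a * b * q ^ (n + 2 + k) = y k := ⟨_, fun _ => rfl⟩
  have nx (k : ℕ) : x k ≠ 0 := hx k ▸ ha k
  have ny (k : ℕ) : y k ≠ 0 := hy k ▸ hab k
  have eA (k : ℕ) : qPoch q (a * q * q) k = qPoch q (a * q) k * x k / x 0 := by
    rw [qPoch_mul_self (by convert ha 0 using 2; ring), ← hx, ← hx]; ring
  have eD (k : ℕ) : qPoch q (a * q * b * q ^ (n + 1 + 1)) k =
      qPoch q (a * b * q ^ (n + 2)) k * y k / y 0 := by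
    rw [show a * q * b * q ^ (n + 1 + 1) = a * b * q ^ (n + 2) * q by ring,
      qPoch_mul_self (by convert hab 0 using 2), ← hy, ← hy]; ring
  have e2 : a * q * b * q ^ (n + 1) = a * b * q ^ (n + 2) := by ring
  have sA : qPoch q (a * q) (n + 1) = qPoch q (a * q) n * x n := by
    rw [qPoch_succ, ← hx]; ring
  have sC : qPoch q (c * q) (n + 1) = qPoch q (c * q) n * (1 - c * q ^ (n + 1)) := by
    rw [qPoch_succ]; ring
  have sD : qPoch q (a * b * q ^ (n + 2)) (n + 1) = qPoch q (a * b * q ^ (n + 2)) n * y n := by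
    rw [qPoch_succ, ← hy]; ring
  apply sum_qPoch_contiguous
  · intro i hi
    have nd := pow_sub_pow_ne_zero hq0 hq1 hi
    have t := qPoch_inv_pow_succ hq0.ne' n i
    rw [← eq_div_iff nd] at t
    have nE := qPoch_self_ne_zero hq0 hq1 i
    simp only [bigQJacobiCoeff, e2, eA, eD, t, sA, sC, sD, hy]
    generalize hd : q ^ (n + 1) - q ^ i = d at nd
    generalize qPoch q ((q ^ n)⁻¹) i = T
    generalize qPoch q q i = E at *
    generalize qPoch q (a * q) = A at *
    generalize qPoch q (c * q) = B at *
    generalize qPoch q (a * b * q ^ (n + 2)) = D at *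
    have n1 := nA n
    have n2 := nA i
    have n3 := nC n
    have n4 := nC i
    have n5 := nD n
    have n6 := nD i
    have m1 := nx 0
    have m2 := nx i
    have m3 := nx n
    have m4 := nx (n + 1)
    have m5 := ny 0
    have m6 := ny i
    have m7 := ny n
    have m8 := ny (n + 1)
    field_simp
    simp only [← hx, ← hy, ← hd]
    ring
  · rw [bigQJacobiCoeff_self ha hc hab, bigQJacobiCoeff_self (fun j => ?_) hc fun j => ?_]
    · convert ha (j + 1) using 2; ring
    · convert hab (j + 1) using 2; ring

theorem bigQJacobi_contiguous_b {q a b c : ℝ} (hq0 : 0 < q) (hq1 : q < 1) {n : ℕ}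
    (ha : ∀ j, 1 - a * q ^ (j + 1) ≠ 0) (hc : ∀ j, 1 - c * q ^ (j + 1) ≠ 0)
    (hab : ∀ j, 1 - a * b * q ^ (n + 2 + j) ≠ 0) :
    bigQJacobi q a b c (n + 1) = bigQJacobi q a (b * q) c (n + 1) +
      C (a * b * q ^ (n + 2) * (1 - q ^ (n + 1)) * (1 - a * q ^ (n + 1)) *
        (1 - c * q ^ (n + 1)) /
        ((1 - a * b * q ^ (n + 2 + n)) * (1 - a * b * q ^ (n + 2 + (n + 1))))) *
        bigQJacobi q a (b * q) c n := by
  simp only [bigQJacobi_eq_sum]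
  have nA (k : ℕ) : qPoch q (a * q) k ≠ 0 := qPoch_ne_zero fun j _ => by
    convert ha j using 2; ring
  have nC (k : ℕ) : qPoch q (c * q) k ≠ 0 := qPoch_ne_zero fun j _ => by
    convert hc j using 2; ring
  have nD (k : ℕ) : qPoch q (a * b * q ^ (n + 2)) k ≠ 0 := qPoch_ne_zero fun j _ => by
    convert hab j using 2; ring
  obtain ⟨y, hy⟩ : ∃ y : ℕ → ℝ, ∀ k, 1 - a * b * q ^ (n + 2 + k) = y k := ⟨_, fun _ => rfl⟩
  have ny (k : ℕ) : y k ≠ 0 := hy k ▸ hab k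
  have eD (k : ℕ) : qPoch q (a * (b * q) * q ^ (n + 1 + 1)) k =
      qPoch q (a * b * q ^ (n + 2)) k * y k / y 0 := by
    rw [show a * (b * q) * q ^ (n + 1 + 1) = a * b * q ^ (n + 2) * q by ring,
      qPoch_mul_self (by convert hab 0 using 2), ← hy, ← hy]; ring
  have e2 : a * (b * q) * q ^ (n + 1) = a * b * q ^ (n + 2) := by ring
  have sA : qPoch q (a * q) (n + 1) = qPoch q (a * q) n * (1 - a * q ^ (n + 1)) := by
    rw [qPoch_succ]; ring
  have sC : qPoch q (c * q) (n + 1) = qPoch q (c * q) n * (1 - c * q ^ (n + 1)) := by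
    rw [qPoch_succ]; ring
  have sD : qPoch q (a * b * q ^ (n + 2)) (n + 1) = qPoch q (a * b * q ^ (n + 2)) n * y n := by
    rw [qPoch_succ, ← hy]; ring
  apply sum_qPoch_contiguous
  · intro i hi
    have nd := pow_sub_pow_ne_zero hq0 hq1 hi
    have t := qPoch_inv_pow_succ hq0.ne' n i
    rw [← eq_div_iff nd] at t
    have nE := qPoch_self_ne_zero hq0 hq1 i
    simp only [bigQJacobiCoeff, e2, eD, t, sA, sC, sD, hy]
    generalize hd : q ^ (n + 1) - q ^ i = d at nd
    generalize qPoch q ((q ^ n)⁻¹) i = T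
    generalize qPoch q q i = E at *
    generalize qPoch q (a * q) = A at *
    generalize qPoch q (c * q) = B at *
    generalize qPoch q (a * b * q ^ (n + 2)) = D at *
    have n1 := nA n
    have n2 := nA i
    have n3 := nC n
    have n4 := nC i
    have n5 := nD n
    have n6 := nD i
    have m5 := ny 0
    have m6 := ny i
    have m7 := ny n
    have m8 := ny (n + 1)
    field_simp
    simp only [← hy, ← hd]
    ring
  · rw [bigQJacobiCoeff_self ha hc hab, bigQJacobiCoeff_self ha hc fun j => ?_]
    convert hab (j + 1) using 2; ring

/-- The big `q`-Jacobi polynomial depends on `a`, `b`, `c` through `a b` and the pair `{a, c}`. -/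
theorem bigQJacobi_swap (q : ℝ) {a b c a' b' : ℝ} (h : a' * b' = a * b) (n : ℕ)
    (hca : a' = c) : bigQJacobi q a b c n = bigQJacobi q a' b' a n := by
  subst hca
  simp only [bigQJacobi, h, mul_comm (qPoch q (a * q) _)]

/-! ### The weight -/

theorem qPochInf_multipliable {q : ℝ} (hq0 : 0 < q) (hq1 : q < 1) (a : ℝ) :
    Multipliable fun j : ℕ => 1 - a * q ^ j := by
  have h : Summable fun j : ℕ => -(a * q ^ j) :=
    ((summable_geometric_of_lt_one hq0.le hq1).mul_left a).neg
  simpa only [sub_eq_add_neg] using Real.multipliable_one_add_of_summable h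

theorem qPochInf_eq {q : ℝ} (hq0 : 0 < q) (hq1 : q < 1) (a : ℝ) :
    qPochInf q a = (1 - a) * qPochInf q (a * q) := by
  have h : (fun j : ℕ => 1 - a * q ^ (j + 1)) = fun j : ℕ => 1 - a * q * q ^ j := by
    ext j; ring
  rw [qPochInf, tprod_eq_zero_mul' (by rw [h]; exact qPochInf_multipliable hq0 hq1 _), h,
    pow_zero, mul_one, qPochInf]

theorem qPochInf_eq_qPoch_mul {q : ℝ} (hq0 : 0 < q) (hq1 : q < 1) (a : ℝ) (n : ℕ) :
    qPochInf q a = qPoch q a n * qPochInf q (a * q ^ n) := by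
  induction n with
  | zero => simp [qPoch_zero]
  | succ n ih => rw [ih, qPoch_succ, qPochInf_eq hq0 hq1 (a * q ^ n)]; ring_nf

theorem one_sub_mul_pow_pos {q a : ℝ} (hq0 : 0 < q) (hq1 : q < 1) (ha : a < 1) (j : ℕ) :
    0 < 1 - a * q ^ j := by
  have h1 : q ^ j ≤ 1 := pow_le_one₀ hq0.le hq1.le
  have h2 : 0 < q ^ j := pow_pos hq0 j
  nlinarith

theorem qPoch_pos {q a : ℝ} (hq0 : 0 < q) (hq1 : q < 1) (ha : a < 1) (n : ℕ) :
    0 < qPoch q a n :=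
  Finset.prod_pos fun j _ => one_sub_mul_pow_pos hq0 hq1 ha j

theorem tendsto_qPoch {q : ℝ} (hq0 : 0 < q) (hq1 : q < 1) (a : ℝ) :
    Tendsto (fun n => qPoch q a n) atTop (𝓝 (qPochInf q a)) :=
  (qPochInf_multipliable hq0 hq1 a).tendsto_prod_tprod_nat

/-- A limit of positive partial products is nonnegative, and an infinite product with summable
deviations and no zero factor is nonzero. -/
theorem qPochInf_pos {q a : ℝ} (hq0 : 0 < q) (hq1 : q < 1) (ha : a < 1) :
    0 < qPochInf q a := by
  refine lt_of_le_of_ne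
    (ge_of_tendsto' (tendsto_qPoch hq0 hq1 a) fun n => (qPoch_pos hq0 hq1 ha n).le) (Ne.symm ?_)
  have h : Summable fun j : ℕ => ‖-(a * q ^ j)‖ :=
    (((summable_geometric_of_lt_one hq0.le hq1).mul_left a).neg).norm
  have := tprod_one_add_ne_zero_of_summable (f := fun j : ℕ => -(a * q ^ j))
    (fun j => by
      rw [← sub_eq_add_neg]; exact (one_sub_mul_pow_pos hq0 hq1 ha j).ne') h
  simpa only [qPochInf, sub_eq_add_neg] using this

theorem tendsto_qPochInf {q a : ℝ} (hq0 : 0 < q) (hq1 : q < 1) (ha : a < 1) :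
    Tendsto (fun n : ℕ => qPochInf q (a * q ^ n)) atTop (𝓝 1) := by
  have h0 := (qPochInf_pos hq0 hq1 ha).ne'
  have h : (fun n : ℕ => qPochInf q (a * q ^ n)) = fun n => qPochInf q a / qPoch q a n := by
    ext n
    rw [eq_div_iff (qPoch_pos hq0 hq1 ha n).ne', qPochInf_eq_qPoch_mul hq0 hq1 a n, mul_comm]
  rw [h, ← div_self h0]
  exact tendsto_const_nhds.div (tendsto_qPoch hq0 hq1 a) h0

/-- The conditions on the parameters under which the weight of the big `q`-Jacobi polynomials is
positive. -/
structure BigQJacobiParams (q α β γ : ℝ) : Prop where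
  q_pos : 0 < q
  q_lt_one : q < 1
  α_pos : 0 < α * q
  α_lt : α * q < 1
  β_nonneg : 0 ≤ β * q
  β_lt : β * q < 1
  γ_neg : γ < 0

theorem bigQJacobiWeight_args_lt_one {q α β γ x : ℝ} (h : BigQJacobiParams q α β γ)
    (hx : x ∈ Set.Icc (γ * q) (α * q)) :
    α⁻¹ * x < 1 ∧ γ⁻¹ * x < 1 ∧ x < 1 ∧ β * γ⁻¹ * x < 1 := by
  obtain ⟨hq0, hq1, hα0, hα1, hβ0, hβ1, hγ⟩ := h
  obtain ⟨h1, h2⟩ := hx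
  have hα : 0 < α := pos_of_mul_pos_left hα0 hq0.le
  have hβ : 0 ≤ β := nonneg_of_mul_nonneg_left hβ0 hq0
  have hγx : γ⁻¹ * x ≤ q := by
    rw [← div_eq_inv_mul, div_le_iff_of_neg hγ]; linarith
  refine ⟨?_, hγx.trans_lt hq1, h2.trans_lt hα1, ?_⟩
  · rw [← div_eq_inv_mul, div_lt_iff₀ hα]; nlinarith
  · rw [mul_assoc]; exact (mul_le_mul_of_nonneg_left hγx hβ).trans_lt hβ1

theorem bigQJacobiWeight_pos {q α β γ x : ℝ} (h : BigQJacobiParams q α β γ)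
    (hx : x ∈ Set.Icc (γ * q) (α * q)) : 0 < bigQJacobiWeight q α β γ x := by
  obtain ⟨hq0, hq1, -⟩ := id h
  obtain ⟨h1, h2, h3, h4⟩ := bigQJacobiWeight_args_lt_one h hx
  exact div_pos (mul_pos (qPochInf_pos hq0 hq1 h1) (qPochInf_pos hq0 hq1 h2))
    (mul_pos (qPochInf_pos hq0 hq1 h3) (qPochInf_pos hq0 hq1 h4))

/-- This serves twice: it bounds the weight along the lattice, giving convergence, and it gives the
boundary value at `0` of telescoping sums. -/
theorem tendsto_bigQJacobiWeight {q α β γ x : ℝ} (h : BigQJacobiParams q α β γ)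
    (hx : x ∈ Set.Icc (γ * q) (α * q)) :
    Tendsto (fun j : ℕ => bigQJacobiWeight q α β γ (x * q ^ j)) atTop (𝓝 1) := by
  obtain ⟨hq0, hq1, -⟩ := id h
  obtain ⟨h1, h2, h3, h4⟩ := bigQJacobiWeight_args_lt_one h hx
  have := ((tendsto_qPochInf hq0 hq1 h1).mul (tendsto_qPochInf hq0 hq1 h2)).div
    ((tendsto_qPochInf hq0 hq1 h3).mul (tendsto_qPochInf hq0 hq1 h4)) (by norm_num)
  simpa only [bigQJacobiWeight, Pi.div_def, mul_assoc, mul_one, div_one] using this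

/-- The Pearson equation of the weight. -/
theorem bigQJacobiWeight_pearson {q α β γ x : ℝ} (h : BigQJacobiParams q α β γ)
    (hx : x ∈ Set.Icc (γ * q) (α * q)) :
    (1 - x) * (1 - β * γ⁻¹ * x) * bigQJacobiWeight q α β γ x =
      (1 - α⁻¹ * x) * (1 - γ⁻¹ * x) * bigQJacobiWeight q α β γ (x * q) := by
  obtain ⟨hq0, hq1, -⟩ := id h
  obtain ⟨h1, h2, h3, h4⟩ := bigQJacobiWeight_args_lt_one h hx
  have h5 : 0 < qPochInf q (x * q) := qPochInf_pos hq0 hq1 (by nlinarith)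
  have h6 : 0 < qPochInf q (β * γ⁻¹ * x * q) := qPochInf_pos hq0 hq1 (by nlinarith)
  have h7 := sub_pos.2 h3
  have h8 := sub_pos.2 h4
  simp only [bigQJacobiWeight, ← mul_assoc]
  rw [qPochInf_eq hq0 hq1 (α⁻¹ * x), qPochInf_eq hq0 hq1 (γ⁻¹ * x), qPochInf_eq hq0 hq1 x,
    qPochInf_eq hq0 hq1 (β * γ⁻¹ * x)]
  generalize qPochInf q (β * γ⁻¹ * x * q) = B at *
  generalize qPochInf q (x * q) = A at *
  generalize 1 - β * γ⁻¹ * x = u at *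
  generalize 1 - x = v at *
  generalize 1 - α⁻¹ * x = s
  generalize 1 - γ⁻¹ * x = t
  field_simp

/-! ### The moment functional -/

namespace BigQJacobiParams

variable {q α β γ : ℝ} (h : BigQJacobiParams q α β γ)
include h

theorem α_mem : α * q ∈ Set.Icc (γ * q) (α * q) :=
  ⟨by nlinarith [h.α_pos, h.γ_neg, h.q_pos], le_rfl⟩

theorem γ_mem : γ * q ∈ Set.Icc (γ * q) (α * q) :=
  ⟨le_rfl, by nlinarith [h.α_pos, h.γ_neg, h.q_pos]⟩

theorem mul_pow_mem {x : ℝ} (hx : x ∈ Set.Icc (γ * q) (α * q)) (j : ℕ) :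
    x * q ^ j ∈ Set.Icc (γ * q) (α * q) := by
  have h1 : q ^ j ≤ 1 := pow_le_one₀ h.q_pos.le h.q_lt_one.le
  have h2 : 0 < q ^ j := pow_pos h.q_pos j
  have h3 : γ * q < 0 := mul_neg_of_neg_of_pos h.γ_neg h.q_pos
  have h4 := h.α_pos
  obtain ⟨hx1, hx2⟩ := hx
  constructor <;> nlinarith

theorem tendsto_mul_pow (x : ℝ) : Tendsto (fun j : ℕ => x * q ^ j) atTop (𝓝 0) := by
  simpa using (tendsto_pow_atTop_nhds_zero_of_lt_one h.q_pos.le h.q_lt_one).const_mul x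

theorem tendsto_eval_mul_pow (p : ℝ[X]) (x : ℝ) :
    Tendsto (fun j : ℕ => p.eval (x * q ^ j)) atTop (𝓝 (p.eval 0)) :=
  (p.continuous.tendsto 0).comp (h.tendsto_mul_pow x)

theorem summable {x : ℝ} (hx : x ∈ Set.Icc (γ * q) (α * q)) (p : ℝ[X]) :
    Summable fun j : ℕ =>
      p.eval (x * q ^ j) * bigQJacobiWeight q α β γ (x * q ^ j) * q ^ j := by
  have hO := ((h.tendsto_eval_mul_pow p x).mul (tendsto_bigQJacobiWeight h hx)).isBigO_one ℝ
  refine summable_of_isBigO_nat (summable_geometric_of_lt_one h.q_pos.le h.q_lt_one) ?_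
  simpa using hO.mul (Asymptotics.isBigO_refl (fun j : ℕ => q ^ j) atTop)

theorem qIntegrable (p : ℝ[X]) : QIntegrable q (γ * q) (α * q)
    fun x => p.eval x * bigQJacobiWeight q α β γ x :=
  ⟨h.summable h.γ_mem p, h.summable h.α_mem p⟩

/-- The linear functional `p ↦ ∫ p(x) w(x) d_q x`. -/
noncomputable def functional : ℝ[X] →ₗ[ℝ] ℝ where
  toFun p := qIntegral q (γ * q) (α * q) fun x => p.eval x * bigQJacobiWeight q α β γ x
  map_add' p₁ p₂ := by
    simp only [qIntegral, eval_add, add_mul]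
    rw [(h.summable h.γ_mem p₁).tsum_add (h.summable h.γ_mem p₂),
      (h.summable h.α_mem p₁).tsum_add (h.summable h.α_mem p₂)]
    ring
  map_smul' r p := by
    simp only [qIntegral, eval_smul, smul_eq_mul, mul_assoc, tsum_mul_left, RingHom.id_apply]
    ring

/-- Since `γ < 0 < α`, both halves contribute with nonnegative sign. The half at `α` is strictly
positive because a nonzero polynomial cannot vanish at all the points `α q^{j+1}`. -/
theorem functional_pos {p : ℝ[X]} (hp : p ≠ 0)
    (hp0 : ∀ x ∈ Set.Icc (γ * q) (α * q), 0 ≤ p.eval x) : 0 < h.functional p := by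
  have hw {x : ℝ} (hx : x ∈ Set.Icc (γ * q) (α * q)) := bigQJacobiWeight_pos h hx
  have hq := h.q_pos
  have key {x : ℝ} (hx : x ∈ Set.Icc (γ * q) (α * q)) (j : ℕ) :
      0 ≤ p.eval (x * q ^ j) * bigQJacobiWeight q α β γ (x * q ^ j) * q ^ j :=
    mul_nonneg (mul_nonneg (hp0 _ (h.mul_pow_mem hx j)) (hw (h.mul_pow_mem hx j)).le)
      (pow_pos hq j).le
  obtain ⟨j, hj⟩ : ∃ j : ℕ, p.eval (α * q * q ^ j) ≠ 0 := by
    by_contra! hcon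
    refine hp (p.eq_zero_of_infinite_isRoot
      (Set.infinite_of_injective_forall_mem (f := fun j : ℕ => α * q * q ^ j) ?_ hcon))
    intro i j hij
    exact (pow_right_strictAnti₀ hq h.q_lt_one).injective
      (mul_left_cancel₀ h.α_pos.ne' hij)
  have hmem := h.mul_pow_mem h.α_mem j
  have h1 : 0 < ∑' j : ℕ,
      p.eval (α * q * q ^ j) * bigQJacobiWeight q α β γ (α * q * q ^ j) * q ^ j :=
    (h.summable h.α_mem p).tsum_pos (key h.α_mem) j
      (mul_pos (mul_pos ((hp0 _ hmem).lt_of_ne' hj) (hw hmem)) (pow_pos hq j))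
  have h2 : 0 ≤ ∑' j : ℕ,
      p.eval (γ * q * q ^ j) * bigQJacobiWeight q α β γ (γ * q * q ^ j) * q ^ j :=
    tsum_nonneg (key h.γ_mem)
  have h3 : 0 < α * q * (1 - q) := mul_pos h.α_pos (sub_pos.2 h.q_lt_one)
  have h4 : γ * q * (1 - q) < 0 :=
    mul_neg_of_neg_of_pos (mul_neg_of_neg_of_pos h.γ_neg hq) (sub_pos.2 h.q_lt_one)
  have h5 := mul_pos h3 h1
  have h6 := mul_nonpos_of_nonpos_of_nonneg h4.le h2
  change 0 < α * q * (1 - q) * _ - γ * q * (1 - q) * _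
  exact sub_pos.2 (h6.trans_lt h5)

end BigQJacobiParams

/-! ### Quasi-orthogonality for an abstract functional -/

/-- `L (x^j Q)` vanishes for `j < n - r` and does not vanish for `j = n - r`. -/
def IsQuasiOrthogonalFor (L : ℝ[X] →ₗ[ℝ] ℝ) (Q : ℝ[X]) (n r : ℕ) : Prop :=
  (∀ j < n - r, L (X ^ j * Q) = 0) ∧ L (X ^ (n - r) * Q) ≠ 0

/-- For `j ≤ n - r` the power is below the threshold `n + 1 - r` of `A`, so at `j = n - r` only `B`
contributes. The bound `r ≤ n` keeps the truncated subtraction honest. -/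
theorem IsQuasiOrthogonalFor.add_C_mul {L : ℝ[X] →ₗ[ℝ] ℝ} {A B : ℝ[X]} {n r : ℕ} {K : ℝ}
    (hr : r ≤ n) (hA : IsQuasiOrthogonalFor L A (n + 1) r) (hB : IsQuasiOrthogonalFor L B n r)
    (hK : K ≠ 0) : IsQuasiOrthogonalFor L (A + C K * B) (n + 1) (r + 1) := by
  have hL (j : ℕ) : L (X ^ j * (A + C K * B)) = L (X ^ j * A) + K * L (X ^ j * B) := by
    rw [← smul_eq_mul K, ← map_smul, ← map_add, smul_eq_C_mul]
    ring_nf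
  rw [IsQuasiOrthogonalFor, Nat.add_sub_add_right]
  refine ⟨fun j hj => ?_, ?_⟩
  · rw [hL, hA.1 j (by omega), hB.1 j hj, mul_zero, add_zero]
  · rw [hL, hA.1 _ (by omega), zero_add]
    exact mul_ne_zero hK hB.2

theorem IsQuasiOrthogonalFor.apply_eq_zero {L : ℝ[X] →ₗ[ℝ] ℝ} {Q p : ℝ[X]} {n r : ℕ}
    (hQ : IsQuasiOrthogonalFor L Q n r) (hp : p.natDegree < n - r) : L (Q * p) = 0 := by
  rw [p.as_sum_range_C_mul_X_pow, Finset.mul_sum, map_sum]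
  refine Finset.sum_eq_zero fun j hj => ?_
  rw [show Q * (C (p.coeff j) * X ^ j) = p.coeff j • (X ^ j * Q) by rw [smul_eq_C_mul]; ring,
    map_smul, hQ.1 j ((Finset.mem_range_succ_iff.1 hj).trans_lt hp), smul_zero]

/-- Reducing `p` modulo `P_d` for decreasing `d` expresses it through lower `P_d`. Hence `L` kills
`p P_n` below degree `n`, while `X ^ n` leaves a nonzero multiple of `L (P_n ^ 2)`. -/
theorem isQuasiOrthogonalFor_zero_of_orthogonal {L : ℝ[X] →ₗ[ℝ] ℝ} {P : ℕ → ℝ[X]}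
    (hdeg : ∀ n, (P n).degree = n) (horth : ∀ m n, m ≠ n → L (P m * P n) = 0)
    (hsq : ∀ n, L (P n * P n) ≠ 0) (n : ℕ) : IsQuasiOrthogonalFor L (P n) n 0 := by
  have hlead (d : ℕ) : (P d).coeff d ≠ 0 := by
    have : (P d).natDegree = d := natDegree_eq_of_degree_eq_some (hdeg d)
    have h0 : P d ≠ 0 := fun h0 => by simpa [h0] using hdeg d
    simpa [leadingCoeff, this] using leadingCoeff_ne_zero.2 h0
  have hred (d : ℕ) (p : ℝ[X]) (hp : p.degree < (d + 1 : ℕ)) :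
      (p - C (p.coeff d / (P d).coeff d) * P d).degree < d := by
    rw [degree_lt_iff_coeff_zero] at hp ⊢
    intro m hm
    rw [coeff_sub, coeff_C_mul]
    rcases hm.eq_or_lt with rfl | hm
    · rw [div_mul_cancel₀ _ (hlead _), sub_self]
    · rw [hp m hm, coeff_eq_zero_of_degree_lt (p := P d) (n := m) (by rw [hdeg]; exact_mod_cast hm), mul_zero,
        sub_zero]
  have hsplit (d : ℕ) (p : ℝ[X]) : L (p * P n) =
      L ((p - C (p.coeff d / (P d).coeff d) * P d) * P n) +
        p.coeff d / (P d).coeff d * L (P d * P n) := by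
    rw [← smul_eq_mul (_ / _), ← map_smul, ← map_add, smul_eq_C_mul]
    ring_nf
  have hlow (d : ℕ) : d ≤ n → ∀ p : ℝ[X], p.degree < d → L (p * P n) = 0 := by
    induction d with
    | zero =>
      intro _ p hp
      have : p = 0 := by simpa using hp
      simp [this]
    | succ d ih =>
      intro hd p hp
      rw [hsplit d, ih (by omega) _ (hred d p hp), horth d n (by omega), mul_zero, add_zero]
  refine ⟨fun j hj => hlow n le_rfl _ ?_, ?_⟩
  · rw [degree_X_pow]; exact_mod_cast hj
  · rw [Nat.sub_zero, hsplit n, hlow n le_rfl _ (hred n _ ?_), zero_add]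
    · rw [coeff_X_pow_self]
      exact mul_ne_zero (one_div_ne_zero (hlead n)) (hsq n)
    · rw [degree_X_pow]; exact_mod_cast n.lt_succ_self

/-! ### Sign changes -/

/-- The roots at which a polynomial changes its sign in an open interval. -/
theorem exists_finset_roots_const_sign (a b : ℝ) (Q : ℝ[X]) (hQ : Q ≠ 0) :
    ∃ s : Finset ℝ, (∀ x ∈ s, x ∈ Set.Ioo a b ∧ Q.IsRoot x) ∧
      ((∀ x ∈ Set.Ioo a b, 0 ≤ (Q * ∏ r ∈ s, (X - C r)).eval x) ∨
        ∀ x ∈ Set.Ioo a b, (Q * ∏ r ∈ s, (X - C r)).eval x ≤ 0) := by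
  induction hd : Q.natDegree generalizing Q with
  | zero =>
    refine ⟨∅, by simp, ?_⟩
    rw [eq_C_of_natDegree_eq_zero hd]
    simpa using (le_total 0 (Q.coeff 0)).imp (fun h _ _ _ => h) fun h _ _ _ => h
  | succ d ih =>
    by_cases hroot : ∃ r ∈ Set.Ioo a b, Q.IsRoot r
    · obtain ⟨r, hr, hQr⟩ := hroot
      obtain ⟨R, rfl⟩ := dvd_iff_isRoot.2 hQr
      have hR : R ≠ 0 := right_ne_zero_of_mul hQ
      rw [natDegree_mul (X_sub_C_ne_zero r) hR, natDegree_X_sub_C] at hd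
      obtain ⟨s, hs, hsign⟩ := ih R hR (by omega)
      have hs' : ∀ x ∈ s, x ∈ Set.Ioo a b ∧ ((X - C r) * R).IsRoot x := fun x hx =>
        ⟨(hs x hx).1, root_mul_left_of_isRoot _ (hs x hx).2⟩
      -- A new factor at `r` toggles membership of `r`: if `r` was already in the set, its linear
      -- factor is absorbed into the polynomial; otherwise inserting it creates a square.
      by_cases hrs : r ∈ s
      · refine ⟨s.erase r, fun x hx => hs' x (Finset.mem_of_mem_erase hx), ?_⟩
        rwa [mul_comm (X - C r), mul_assoc, Finset.mul_prod_erase s (fun r => X - C r) hrs]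
      · refine ⟨insert r s, fun x hx => ?_, ?_⟩
        · rcases Finset.mem_insert.1 hx with rfl | hx
          · exact ⟨hr, hQr⟩
          · exact hs' x hx
        · have hev (x : ℝ) : ((X - C r) * R * ∏ r ∈ insert r s, (X - C r)).eval x =
              (x - r) ^ 2 * (R * ∏ r ∈ s, (X - C r)).eval x := by
            rw [Finset.prod_insert hrs]
            simp only [eval_mul, eval_sub, eval_X, eval_C]
            ring
          simp only [hev]
          exact hsign.imp (fun h x hx => mul_nonneg (sq_nonneg _) (h x hx))
            fun h x hx => mul_nonpos_of_nonneg_of_nonpos (sq_nonneg _) (h x hx)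
    · push Not at hroot
      refine ⟨∅, by simp, ?_⟩
      simp only [Finset.prod_empty, mul_one]
      -- Without a root in the interval, opposite signs would contradict the intermediate value
      -- theorem.
      by_contra! hcon
      obtain ⟨⟨x, hx, hx0⟩, ⟨y, hy, hy0⟩⟩ := hcon
      obtain ⟨z, hz, hz0⟩ := isPreconnected_Ioo.intermediate_value hx hy
        Q.continuous.continuousOn ⟨hx0.le, hy0.le⟩
      exact hroot z hz hz0

theorem nonneg_on_Icc_of_nonneg_on_Ioo {a b : ℝ} (hab : a < b) {p : ℝ[X]}
    (hp : ∀ x ∈ Set.Ioo a b, 0 ≤ p.eval x) : ∀ x ∈ Set.Icc a b, 0 ≤ p.eval x := by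
  rw [← closure_Ioo hab.ne]
  exact fun x hx => closure_minimal hp (isClosed_Ici.preimage p.continuous) hx

theorem IsQuasiOrthogonalFor.hasAtLeastZeros {a b : ℝ} (hab : a < b) {L : ℝ[X] →ₗ[ℝ] ℝ}
    (hL : ∀ p : ℝ[X], p ≠ 0 → (∀ x ∈ Set.Icc a b, 0 ≤ p.eval x) → 0 < L p)
    {Q : ℝ[X]} {n r : ℕ} (hQ : IsQuasiOrthogonalFor L Q n r) :
    HasAtLeastZeros Q (n - r) a b := by
  have hQ0 : Q ≠ 0 := by
    rintro rfl
    simpa using hQ.2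
  obtain ⟨s, hs, hsign⟩ := exists_finset_roots_const_sign a b Q hQ0
  refine ⟨s, ?_, hs⟩
  by_contra! hcard
  have h0 : L (Q * ∏ r ∈ s, (X - C r)) = 0 := hQ.apply_eq_zero (by
    rwa [natDegree_prod_of_monic _ _ fun r _ => monic_X_sub_C r, Finset.sum_congr rfl
      fun r _ => natDegree_X_sub_C r, Finset.sum_const, smul_eq_mul, mul_one])
  have hne : Q * ∏ r ∈ s, (X - C r) ≠ 0 :=
    mul_ne_zero hQ0 (Finset.prod_ne_zero_iff.2 fun r _ => X_sub_C_ne_zero r)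
  rcases hsign with h | h
  · exact (hL _ hne (nonneg_on_Icc_of_nonneg_on_Ioo hab h)).ne' h0
  · have := hL _ (neg_ne_zero.2 hne) (nonneg_on_Icc_of_nonneg_on_Ioo hab fun x hx => by
      rw [eval_neg]; exact neg_nonneg.2 (h x hx))
    rw [map_neg, h0, neg_zero] at this
    exact this.false

/-! ### The `q`-difference equation -/

/-- The operator is bidiagonal in the basis `(x; q)_i`. Taking `x = q y` and scaling by `q ^ (i +
1)` avoids inverse powers of `q`. -/
theorem qPoch_qDifference (q a b c y : ℝ) (i : ℕ) :
    q ^ (i + 1) *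
      (a * q * (q * y - 1) * (b * (q * y) - c) *
          (qPoch q (q * (q * y)) (i + 1) - qPoch q (q * y) (i + 1)) +
        (q * y - a * q) * (q * y - c * q) * (qPoch q y (i + 1) - qPoch q (q * y) (i + 1))) =
      (q * y) ^ 2 * (1 - q ^ (i + 1)) *
        ((1 - a * b * q ^ (i + 2)) * qPoch q (q * y) (i + 1) -
          (1 - a * q ^ (i + 1)) * (1 - c * q ^ (i + 1)) * qPoch q (q * y) i) := by
  have h := qPoch_mul_last q (q * y) i
  have e := qPoch_succ' q y i
  rw [mul_comm y q] at e
  rw [mul_comm (q * y) q] at h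
  simp only [e, qPoch_succ]
  generalize qPoch q (q * (q * y)) i = F at *
  generalize qPoch q (q * y) i = G at *
  simp only [pow_add, pow_one, pow_two]
  generalize q ^ i = I at *
  linear_combination (-(I * q * (a * q * (q * y - 1) * (b * (q * y) - c))) +
    I * q * (a * q * (b * (q * y) - c)) * (q * y) * (1 - I * q)) * h

/-- The eigenvalue of the `q`-difference operator of the big `q`-Jacobi polynomials. -/
noncomputable def bigQJacobiEigenvalue (q a b : ℝ) (i : ℕ) : ℝ :=
  (q ^ i)⁻¹ * (1 - q ^ i) * (1 - a * b * q ^ (i + 1))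

/-- Up to powers of `q`, these factors are the numerator of the coefficient recursion; this match
makes the eigenvalue equation telescope. -/
theorem bigQJacobiEigenvalue_sub {q : ℝ} (hq : q ≠ 0) (a b : ℝ) (i n : ℕ) :
    bigQJacobiEigenvalue q a b i - bigQJacobiEigenvalue q a b n =
      (q ^ i)⁻¹ * (1 - (q ^ n)⁻¹ * q ^ i) * (1 - a * b * q ^ (n + 1) * q ^ i) := by
  have h1 : q ^ i ≠ 0 := pow_ne_zero i hq
  have h2 : q ^ n ≠ 0 := pow_ne_zero n hq
  unfold bigQJacobiEigenvalue
  rw [pow_succ, pow_succ]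
  field_simp
  ring

/-- The `q`-difference equation of the big `q`-Jacobi polynomials. -/
theorem bigQJacobi_qDifference {q a b c : ℝ} (hq0 : 0 < q) (hq1 : q < 1)
    (ha : ∀ j, 1 - a * q ^ (j + 1) ≠ 0) (hc : ∀ j, 1 - c * q ^ (j + 1) ≠ 0) (n : ℕ) (y : ℝ) :
    a * q * (q * y - 1) * (b * (q * y) - c) *
        ((bigQJacobi q a b c n).eval (q * (q * y)) - (bigQJacobi q a b c n).eval (q * y)) +
      (q * y - a * q) * (q * y - c * q) *
        ((bigQJacobi q a b c n).eval y - (bigQJacobi q a b c n).eval (q * y)) =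
      bigQJacobiEigenvalue q a b n * (q * y) ^ 2 * (bigQJacobi q a b c n).eval (q * y) := by
  have hev (x : ℝ) : (bigQJacobi q a b c n).eval x =
      ∑ i ∈ Finset.range (n + 1), bigQJacobiCoeff q a b c n i * qPoch q x i := by
    simp only [bigQJacobi_eq_sum, eval_finsetSum, eval_mul, eval_C, qPoch_eval]
  -- By bidiagonality the partial sum leaves one term, proportional to the eigenvalue difference,
  -- which vanishes at `m = n`.
  have key (m : ℕ) : ∑ i ∈ Finset.range (m + 1), bigQJacobiCoeff q a b c n i *
      (a * q * (q * y - 1) * (b * (q * y) - c) *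
          (qPoch q (q * (q * y)) i - qPoch q (q * y) i) +
        (q * y - a * q) * (q * y - c * q) * (qPoch q y i - qPoch q (q * y) i) -
        bigQJacobiEigenvalue q a b n * (q * y) ^ 2 * qPoch q (q * y) i) =
      bigQJacobiCoeff q a b c n m * (q * y) ^ 2 *
        (bigQJacobiEigenvalue q a b m - bigQJacobiEigenvalue q a b n) *
          qPoch q (q * y) m := by
    induction m with
    | zero =>
      simp only [zero_add, Finset.sum_range_one, qPoch_zero, bigQJacobiEigenvalue, pow_zero]
      ring
    | succ m ih =>
      have hcf := bigQJacobiCoeff_succ (b := b) (i := m) (n := n) hq0 hq1 ha hc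
      have hI : q ^ (m + 1) ≠ 0 := (pow_pos hq0 _).ne'
      have hop := qPoch_qDifference q a b c y m
      rw [Finset.sum_range_succ, ih, bigQJacobiEigenvalue_sub hq0.ne']
      have hI' : q ^ m ≠ 0 := (pow_pos hq0 _).ne'
      apply mul_left_cancel₀ hI
      have e1 : q ^ (m + 1) * (q ^ m)⁻¹ = q := by rw [pow_succ]; field_simp
      have e2 : q ^ (m + 1) * bigQJacobiEigenvalue q a b (m + 1) =
          (1 - q ^ (m + 1)) * (1 - a * b * q ^ (m + 2)) := by
        unfold bigQJacobiEigenvalue; field_simp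
      generalize bigQJacobiEigenvalue q a b n = ln at *
      generalize bigQJacobiEigenvalue q a b (m + 1) = lm at *
      generalize 1 - (q ^ n)⁻¹ * q ^ m = u at *
      generalize 1 - a * b * q ^ (n + 1) * q ^ m = v at *
      generalize bigQJacobiCoeff q a b c n m = k at *
      generalize bigQJacobiCoeff q a b c n (m + 1) = k' at *
      generalize (q ^ m)⁻¹ = J at *
      linear_combination k * (q * y) ^ 2 * u * v * qPoch q (q * y) m * e1 + k' * hop -
        (q * y) ^ 2 * qPoch q (q * y) m * hcf -
        k' * (q * y) ^ 2 * qPoch q (q * y) (m + 1) * e2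
  have := key n
  rw [sub_self, mul_zero, zero_mul] at this
  rw [← sub_eq_zero, ← this, hev, hev, hev]
  simp only [← Finset.sum_sub_distrib, Finset.mul_sum, ← Finset.sum_add_distrib]
  exact Finset.sum_congr rfl fun i _ => by ring

/-! ### Orthogonality for the unshifted parameters -/

namespace BigQJacobiParams

variable {q α β γ : ℝ} (h : BigQJacobiParams q α β γ)
include h

theorem α_pos' : 0 < α := pos_of_mul_pos_left h.α_pos h.q_pos.le

theorem one_sub_α_ne_zero (j : ℕ) : 1 - α * q ^ (j + 1) ≠ 0 := by
  rw [pow_succ', ← mul_assoc]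
  exact (one_sub_mul_pow_pos h.q_pos h.q_lt_one h.α_lt j).ne'

theorem one_sub_γ_ne_zero (j : ℕ) : 1 - γ * q ^ (j + 1) ≠ 0 := by
  have := mul_neg_of_neg_of_pos h.γ_neg (pow_pos h.q_pos (j + 1))
  linarith

theorem one_sub_αβ_pos (j : ℕ) : 0 < 1 - α * β * q ^ (j + 2) := by
  rw [show α * β * q ^ (j + 2) = (α * q) * (β * q) * q ^ j by ring]
  refine one_sub_mul_pow_pos h.q_pos h.q_lt_one ?_ j
  nlinarith [h.α_pos, h.α_lt, h.β_nonneg, h.β_lt]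

theorem eigenvalue_sub_ne_zero {m n : ℕ} (hmn : m ≠ n) :
    bigQJacobiEigenvalue q α β m - bigQJacobiEigenvalue q α β n ≠ 0 := by
  rw [bigQJacobiEigenvalue_sub h.q_pos.ne']
  have hn : q ^ n ≠ 0 := (pow_pos h.q_pos n).ne'
  refine mul_ne_zero (mul_ne_zero (inv_ne_zero (pow_pos h.q_pos m).ne') fun h0 => hmn ?_) ?_
  · have : q ^ m = q ^ n := by
      field_simp at h0
      linarith
    exact (pow_right_strictAnti₀ h.q_pos h.q_lt_one).injective this
  -- Distinct indices have `m + n ≥ 1`, so the exponent is at least `2`, the range where `α β q ^ (j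
  -- + 2) < 1` is available.
  · obtain ⟨k, hk⟩ : ∃ k, m + n = k + 1 := ⟨m + n - 1, by omega⟩
    rw [mul_assoc, ← pow_add, show n + 1 + m = k + 2 by omega]
    exact (h.one_sub_αβ_pos k).ne'

/-- A telescoping sum: the `q`-integral of a total `q`-difference over one half of the lattice. -/
theorem hasSum_pearson (V : ℝ[X]) {x₀ : ℝ} (hx₀ : x₀ * q ∈ Set.Icc (γ * q) (α * q))
    (hzero : (1 - α⁻¹ * x₀) * (1 - γ⁻¹ * x₀) = 0) {f : ℕ → ℝ} (hf : Summable f)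
    (hfV : ∀ j : ℕ, f j = ((1 - x₀ * q ^ (j + 1)) * (1 - β * γ⁻¹ * (x₀ * q ^ (j + 1))) *
        V.eval (x₀ * q ^ (j + 1)) -
      (1 - α⁻¹ * (x₀ * q ^ j)) * (1 - γ⁻¹ * (x₀ * q ^ j)) * V.eval (x₀ * q ^ j)) *
        bigQJacobiWeight q α β γ (x₀ * q ^ (j + 1))) :
    HasSum f (V.eval 0) := by
  let φ : ℝ[X] := (1 - C α⁻¹ * X) * (1 - C γ⁻¹ * X)
  have hφ (x : ℝ) : φ.eval x = (1 - α⁻¹ * x) * (1 - γ⁻¹ * x) := by simp [φ]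
  -- The weight is taken one step further along the lattice than the polynomial, so its argument
  -- stays in the interval although `x₀` lies outside.
  let Z : ℕ → ℝ := fun j =>
    (φ * V).eval (x₀ * q ^ j) * bigQJacobiWeight q α β γ (x₀ * q * q ^ j)
  have hZ : Tendsto Z atTop (𝓝 (V.eval 0)) := by
    have := (h.tendsto_eval_mul_pow (φ * V) x₀).mul (tendsto_bigQJacobiWeight h hx₀)
    simpa [Z, hφ] using this
  have hstep (j : ℕ) : f j = Z (j + 1) - Z j := by
    have hp := bigQJacobiWeight_pearson h (h.mul_pow_mem hx₀ j)
    rw [show x₀ * q * q ^ j = x₀ * q ^ (j + 1) by ring] at hp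
    rw [hfV]
    simp only [Z, eval_mul, hφ]
    rw [show x₀ * q * q ^ (j + 1) = x₀ * q ^ (j + 1) * q by ring,
      show x₀ * q * q ^ j = x₀ * q ^ (j + 1) by ring]
    linear_combination V.eval (x₀ * q ^ (j + 1)) * hp
  have hZ0 : Z 0 = 0 := by simp [Z, hφ, hzero]
  have hsum : Tendsto (fun n => ∑ j ∈ Finset.range n, f j) atTop (𝓝 (V.eval 0)) := by
    simpa only [hstep, Finset.sum_range_sub, hZ0, sub_zero] using hZ
  exact hf.hasSum_iff_tendsto_nat.2 hsum

/-- A discrete Lagrange identity: cross-multiplying the two eigenvalue equations gives the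
`q`-difference of a Casorati determinant. -/
theorem functional_mul_eq_zero {m n : ℕ} (hmn : m ≠ n) :
    h.functional (bigQJacobi q α β γ m * bigQJacobi q α β γ n) = 0 := by
  have hα := h.α_pos'.ne'
  have hγ := h.γ_neg.ne
  have hq := h.q_pos.ne'
  have hdiff (k : ℕ) := bigQJacobi_qDifference (b := β) h.q_pos h.q_lt_one
    h.one_sub_α_ne_zero h.one_sub_γ_ne_zero k
  have hl := h.eigenvalue_sub_ne_zero hmn
  set F := bigQJacobi q α β γ m
  set G := bigQJacobi q α β γ n
  set l := bigQJacobiEigenvalue q α β m - bigQJacobiEigenvalue q α β n with hl_def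
  -- The determinant vanishes at `0`; dividing by `X` compensates for the quadratic factor in the
  -- eigenvalue equation.
  obtain ⟨V, hV⟩ : X ∣ G * F.comp (C q * X) - F * G.comp (C q * X) := by
    rw [X_dvd_iff, coeff_zero_eq_eval_zero]
    simp only [eval_sub, eval_mul, eval_comp, eval_C, eval_X, mul_zero]
    ring
  have hVe (y : ℝ) : G.eval y * F.eval (q * y) - F.eval y * G.eval (q * y) = y * V.eval y := by
    simpa using congrArg (eval y) hV
  have hid (y : ℝ) (hy : y ≠ 0) : l * y * (F * G).eval (y * q) =
      α * γ * ((1 - y * q) * (1 - β * γ⁻¹ * (y * q)) * V.eval (y * q) -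
        (1 - α⁻¹ * y) * (1 - γ⁻¹ * y) * V.eval y) := by
    have h1 := hdiff m y
    have h2 := hdiff n y
    have h3 := hVe y
    have h4 := hVe (q * y)
    have e1 : γ * γ⁻¹ = 1 := mul_inv_cancel₀ hγ
    rw [mul_comm y q, eval_mul]
    have e3 : γ * (1 - β * γ⁻¹ * (q * y)) = γ - β * (q * y) := by
      linear_combination (-β * (q * y)) * e1
    have e4 : α * γ * ((1 - α⁻¹ * y) * (1 - γ⁻¹ * y)) = (α - y) * (γ - y) := by
      field_simp
    have hqy : q ^ 2 * y ≠ 0 := mul_ne_zero (pow_ne_zero 2 hq) hy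
    apply mul_left_cancel₀ hqy
    rw [hl_def]
    linear_combination (-G.eval (q * y)) * h1 + F.eval (q * y) * h2 +
      α * q * (q * y - 1) * (β * (q * y) - γ) * h4 - (q * y - α * q) * (q * y - γ * q) * h3 -
      q ^ 2 * y * α * (1 - q * y) * V.eval (q * y) * e3 + q ^ 2 * y * V.eval y * e4
  -- The boundary term at `x₀` is zero for `x₀ = α` and `x₀ = γ`, and the limit at `0` is common to
  -- both, so the two halves agree.
  have half (x₀ : ℝ) (hx0 : x₀ ≠ 0) (hx₀ : x₀ * q ∈ Set.Icc (γ * q) (α * q))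
      (hzero : (1 - α⁻¹ * x₀) * (1 - γ⁻¹ * x₀) = 0) :
      x₀ * ∑' j : ℕ, (F * G).eval (x₀ * q * q ^ j) *
        bigQJacobiWeight q α β γ (x₀ * q * q ^ j) * q ^ j = α * γ / l * V.eval 0 := by
    have hs := (h.summable hx₀ (F * G)).mul_left (l * x₀ / (α * γ))
    have := (h.hasSum_pearson V hx₀ hzero hs fun j => ?_).tsum_eq
    · rw [tsum_mul_left] at this
      rw [← this]
      field_simp
    · have hj := hid (x₀ * q ^ j) (mul_ne_zero hx0 (pow_ne_zero j hq))
      rw [show x₀ * q * q ^ j = x₀ * q ^ (j + 1) by ring]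
      rw [show x₀ * q ^ j * q = x₀ * q ^ (j + 1) by ring] at hj
      rw [div_mul_eq_mul_div, div_eq_iff (mul_ne_zero hα hγ)]
      linear_combination bigQJacobiWeight q α β γ (x₀ * q ^ (j + 1)) * hj
  have h1 := half α hα h.α_mem (by rw [inv_mul_cancel₀ hα]; ring)
  have h2 := half γ hγ h.γ_mem (by rw [inv_mul_cancel₀ hγ]; ring)
  change α * q * (1 - q) * _ - γ * q * (1 - q) * _ = 0
  linear_combination q * (1 - q) * h1 - q * (1 - q) * h2

theorem isQuasiOrthogonalFor_zero (n : ℕ) :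
    IsQuasiOrthogonalFor h.functional (bigQJacobi q α β γ n) n 0 := by
  have hdeg (n : ℕ) : (bigQJacobi q α β γ n).degree = n := by
    -- Degree `0` is separate: the general criterion would require `1 - α β q ≠ 0`, which the
    -- parameter bounds do not ensure.
    rcases n with - | n
    · simp [bigQJacobi, qPoch_zero]
    · exact bigQJacobi_degree h.q_pos h.q_lt_one h.one_sub_α_ne_zero h.one_sub_γ_ne_zero
        fun j => by
          rw [show n + 1 + 1 + j = n + j + 2 by ring]
          exact (h.one_sub_αβ_pos _).ne'
  refine isQuasiOrthogonalFor_zero_of_orthogonal hdeg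
    (fun m n hmn => h.functional_mul_eq_zero hmn) (fun n => (h.functional_pos ?_ ?_).ne') n
  · have : bigQJacobi q α β γ n ≠ 0 := fun h0 => by simpa [h0] using hdeg n
    exact mul_ne_zero this this
  · intro x _
    rw [eval_mul]
    exact mul_self_nonneg _

end BigQJacobiParams

/-! ### Shifted parameters -/

namespace BigQJacobiParams

variable {q α β γ : ℝ} (h : BigQJacobiParams q α β γ)
include h

theorem isQuasiOrthogonal_and_hasAtLeastZeros {Q : ℝ[X]} {n r : ℕ} (hr : r < n)
    (hdeg : Q.degree = n) (hQ : IsQuasiOrthogonalFor h.functional Q n r) :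
    IsQuasiOrthogonal q (γ * q) (α * q) (bigQJacobiWeight q α β γ) Q n r ∧
      HasAtLeastZeros Q (n - r) (γ * q) (α * q) := by
  have hev (m : ℕ) : (fun x => x ^ m * Q.eval x * bigQJacobiWeight q α β γ x) =
      fun x => (X ^ m * Q).eval x * bigQJacobiWeight q α β γ x := by
    ext x; simp
  refine ⟨⟨fun x hx => bigQJacobiWeight_pos h hx, hr, natDegree_eq_of_degree_eq_some hdeg,
    fun m => ?_, fun m hm => ?_, ?_⟩, hQ.hasAtLeastZeros ?_ fun p hp hp0 =>
      h.functional_pos hp hp0⟩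
  · rw [hev]; exact h.qIntegrable _
  · rw [hev]; exact hQ.1 m hm
  · rw [hev]; exact hQ.2
  · exact (mul_neg_of_neg_of_pos h.γ_neg h.q_pos).trans h.α_pos

theorem one_sub_mul_pow_ne_zero {x : ℝ} {p n : ℕ} (hx : x * q ^ p = α * β) (hp : p ≤ n)
    (j : ℕ) : 1 - x * q ^ (n + 2 + j) ≠ 0 := by
  obtain ⟨k, rfl⟩ := Nat.exists_eq_add_of_le hp
  rw [show x * q ^ (p + k + 2 + j) = α * β * q ^ (k + j + 2) by rw [← hx]; ring]
  exact (h.one_sub_αβ_pos _).ne'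

/-- A zero would mean `α q ^ (j + 1) = q ^ k`. For `j + 1 ≤ k` the left side is larger since `α >
1`; for `j ≥ k` it is smaller since `α q < 1`. -/
theorem one_sub_α_div_ne_zero (hα : 1 < α) (k j : ℕ) : 1 - α / q ^ k * q ^ (j + 1) ≠ 0 := by
  have hk : 0 < q ^ k := pow_pos h.q_pos k
  have hj : 0 < q ^ j := pow_pos h.q_pos j
  intro h0
  have h1 : α * q ^ (j + 1) = q ^ k := by
    field_simp at h0
    linarith
  rcases le_or_gt (j + 1) k with hjk | hjk
  · have := pow_le_pow_of_le_one h.q_pos.le h.q_lt_one.le hjk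
    have := pow_pos h.q_pos (j + 1)
    nlinarith
  · have := pow_le_pow_of_le_one h.q_pos.le h.q_lt_one.le (Nat.lt_succ_iff.1 hjk)
    rw [pow_succ] at h1
    nlinarith [h.α_lt]

theorem one_sub_γ_div_ne_zero (k j : ℕ) : 1 - γ / q ^ k * q ^ (j + 1) ≠ 0 := by
  have := mul_neg_of_neg_of_pos (div_neg_of_neg_of_pos h.γ_neg (pow_pos h.q_pos k))
    (pow_pos h.q_pos (j + 1))
  linarith

theorem one_sub_β_div_ne_zero {m n : ℕ} (hmn : m ≤ n) : 1 - β / q ^ m * q ^ (n + 1) ≠ 0 := by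
  obtain ⟨k, rfl⟩ := Nat.exists_eq_add_of_le hmn
  have hq := (pow_pos h.q_pos m).ne'
  rw [show β / q ^ m * q ^ (m + k + 1) = β * q * q ^ k by
    rw [div_mul_eq_mul_div, div_eq_iff hq]; ring]
  exact (one_sub_mul_pow_pos h.q_pos h.q_lt_one h.β_lt k).ne'

theorem div_pow_succ_mul (x : ℝ) (k : ℕ) : x / q ^ (k + 1) * q = x / q ^ k := by
  have := h.q_pos.ne'
  rw [pow_succ]
  field_simp

theorem isQuasiOrthogonalFor_β (hβ : β ≠ 0) (m : ℕ) : ∀ n, m < n →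
    IsQuasiOrthogonalFor h.functional (bigQJacobi q α (β / q ^ m) γ n) n m := by
  have hq (k : ℕ) : q ^ k ≠ 0 := (pow_pos h.q_pos k).ne'
  induction m with
  | zero => intro n _; simpa using h.isQuasiOrthogonalFor_zero n
  | succ m ih =>
    intro n hn
    obtain ⟨n, rfl⟩ : ∃ n', n = n' + 1 := ⟨n - 1, by omega⟩
    have hab := h.one_sub_mul_pow_ne_zero (x := α * (β / q ^ (m + 1))) (p := m + 1) (n := n)
      (by rw [mul_assoc, div_mul_cancel₀ _ (hq _)]) (by omega)
    rw [bigQJacobi_contiguous_b h.q_pos h.q_lt_one h.one_sub_α_ne_zero h.one_sub_γ_ne_zero hab,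
      h.div_pow_succ_mul]
    refine (ih _ (by omega)).add_C_mul (by omega) (ih _ (by omega)) ?_
    exact div_ne_zero (mul_ne_zero (mul_ne_zero (mul_ne_zero (mul_ne_zero (mul_ne_zero
      h.α_pos'.ne' (div_ne_zero hβ (hq _))) (hq _)) (one_sub_pow_ne_zero h.q_pos h.q_lt_one n))
      (h.one_sub_α_ne_zero n)) (h.one_sub_γ_ne_zero n)) (mul_ne_zero (hab _) (hab _))

/-- The `β`-shift enters as the starting point of the induction on `k`, so `m = 0` covers a pure
`α`-shift. -/
theorem isQuasiOrthogonalFor_α (hα : 1 < α) {m : ℕ} (hm : ∀ n, m < n →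
    IsQuasiOrthogonalFor h.functional (bigQJacobi q α (β / q ^ m) γ n) n m) (k : ℕ) :
    ∀ n, k + m < n →
      IsQuasiOrthogonalFor h.functional (bigQJacobi q (α / q ^ k) (β / q ^ m) γ n) n (k + m) := by
  have hq (k : ℕ) : q ^ k ≠ 0 := (pow_pos h.q_pos k).ne'
  induction k with
  | zero => intro n hn; simpa using hm n (by omega)
  | succ k ih =>
    intro n hn
    obtain ⟨n, rfl⟩ : ∃ n', n = n' + 1 := ⟨n - 1, by omega⟩
    have hab := h.one_sub_mul_pow_ne_zero (x := α / q ^ (k + 1) * (β / q ^ m))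
      (p := k + 1 + m) (n := n)
      (by
        rw [pow_add q (k + 1) m, mul_mul_mul_comm, div_mul_cancel₀ _ (hq _),
          div_mul_cancel₀ _ (hq _)]) (by omega)
    rw [bigQJacobi_contiguous_a h.q_pos h.q_lt_one (h.one_sub_α_div_ne_zero hα (k + 1))
      h.one_sub_γ_ne_zero hab, h.div_pow_succ_mul, Nat.add_right_comm k 1 m]
    refine (ih _ (by omega)).add_C_mul (by omega) (ih _ (by omega)) ?_
    exact neg_ne_zero.2 (div_ne_zero (mul_ne_zero (mul_ne_zero (mul_ne_zero
      (div_ne_zero h.α_pos'.ne' (hq _))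
      (one_sub_pow_ne_zero h.q_pos h.q_lt_one n)) (h.one_sub_β_div_ne_zero (by omega)))
      (h.one_sub_γ_ne_zero n)) (mul_ne_zero (hab _) (hab _)))

theorem isQuasiOrthogonalFor_γ (l : ℕ) : ∀ n, l < n →
    IsQuasiOrthogonalFor h.functional (bigQJacobi q α (β / q ^ l) (γ / q ^ l) n) n l := by
  have hq (k : ℕ) : q ^ k ≠ 0 := (pow_pos h.q_pos k).ne'
  have hγ := h.γ_neg.ne
  -- Exchanging the first and third parameters changes the second to `α β / γ`, which no longer
  -- depends on `l`; only the first parameter then moves.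
  have hswap (l n : ℕ) : bigQJacobi q α (β / q ^ l) (γ / q ^ l) n =
      bigQJacobi q (γ / q ^ l) (α * β / γ) α n :=
    bigQJacobi_swap q (by have := hq l; field_simp) n rfl
  have hb (n : ℕ) : 1 - α * β / γ * q ^ (n + 1) ≠ 0 := by
    have h1 : α * β / γ ≤ 0 := div_nonpos_of_nonneg_of_nonpos
      (mul_nonneg h.α_pos'.le (nonneg_of_mul_nonneg_left h.β_nonneg h.q_pos)) h.γ_neg.le
    have := mul_nonpos_of_nonpos_of_nonneg h1 (pow_pos h.q_pos (n + 1)).le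
    linarith
  induction l with
  | zero => intro n _; simpa using h.isQuasiOrthogonalFor_zero n
  | succ l ih =>
    intro n hn
    obtain ⟨n, rfl⟩ : ∃ n', n = n' + 1 := ⟨n - 1, by omega⟩
    have hab := h.one_sub_mul_pow_ne_zero (x := γ / q ^ (l + 1) * (α * β / γ)) (p := l + 1)
      (n := n) (by have := hq (l + 1); field_simp) (by omega)
    rw [hswap, bigQJacobi_contiguous_a h.q_pos h.q_lt_one (h.one_sub_γ_div_ne_zero (l + 1))
      h.one_sub_α_ne_zero hab, h.div_pow_succ_mul, ← hswap, ← hswap]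
    refine (ih _ (by omega)).add_C_mul (by omega) (ih _ (by omega)) ?_
    exact neg_ne_zero.2 (div_ne_zero (mul_ne_zero (mul_ne_zero (mul_ne_zero
      (div_ne_zero hγ (hq _))
      (one_sub_pow_ne_zero h.q_pos h.q_lt_one n)) (hb n))
      (h.one_sub_α_ne_zero n)) (mul_ne_zero (hab _) (hab _)))

theorem degree_bigQJacobi {a b c : ℝ} {p n : ℕ} (ha : ∀ j, 1 - a * q ^ (j + 1) ≠ 0)
    (hc : ∀ j, 1 - c * q ^ (j + 1) ≠ 0) (hab : a * b * q ^ p = α * β) (hp : p < n) :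
    (bigQJacobi q a b c n).degree = n := by
  refine bigQJacobi_degree h.q_pos h.q_lt_one ha hc fun j => ?_
  obtain ⟨n, rfl⟩ : ∃ n', n = n' + 1 := ⟨n - 1, by omega⟩
  exact h.one_sub_mul_pow_ne_zero hab (by omega) j

end BigQJacobiParams

theorem theorem2p3 (q α β γ : ℝ) (hq0 : 0 < q) (hq1 : q < 1)
    (hα0 : 0 < α * q) (hα1 : α * q < 1) (hβ0 : 0 ≤ β * q) (hβ1 : β * q < 1) (hγ : γ < 0) :
    (1 < α → ∀ k n : ℕ, k < n →
      IsQuasiOrthogonal q (γ * q) (α * q) (bigQJacobiWeight q α β γ)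
          (bigQJacobi q (α / q ^ k) β γ n) n k ∧
        HasAtLeastZeros (bigQJacobi q (α / q ^ k) β γ n) (n - k) (γ * q) (α * q)) ∧
    (1 < β → ∀ m n : ℕ, m < n →
      IsQuasiOrthogonal q (γ * q) (α * q) (bigQJacobiWeight q α β γ)
          (bigQJacobi q α (β / q ^ m) γ n) n m ∧
        HasAtLeastZeros (bigQJacobi q α (β / q ^ m) γ n) (n - m) (γ * q) (α * q)) ∧
    (1 < β → ∀ l n : ℕ, l < n →
      IsQuasiOrthogonal q (γ * q) (α * q) (bigQJacobiWeight q α β γ)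
          (bigQJacobi q α (β / q ^ l) (γ / q ^ l) n) n l ∧
        HasAtLeastZeros (bigQJacobi q α (β / q ^ l) (γ / q ^ l) n) (n - l) (γ * q) (α * q)) ∧
    (1 < α → 1 < β → ∀ k m n : ℕ, k + m < n →
      IsQuasiOrthogonal q (γ * q) (α * q) (bigQJacobiWeight q α β γ)
          (bigQJacobi q (α / q ^ k) (β / q ^ m) γ n) n (k + m) ∧
        HasAtLeastZeros (bigQJacobi q (α / q ^ k) (β / q ^ m) γ n) (n - (k + m))
          (γ * q) (α * q)) := by

  have h : BigQJacobiParams q α β γ := ⟨hq0, hq1, hα0, hα1, hβ0, hβ1, hγ⟩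
  have hq (k : ℕ) : q ^ k ≠ 0 := (pow_pos hq0 k).ne'
  have h4 {m : ℕ} (hα : 1 < α) (hm : ∀ n, m < n →
      IsQuasiOrthogonalFor h.functional (bigQJacobi q α (β / q ^ m) γ n) n m) (k n : ℕ)
      (hkm : k + m < n) :=
    h.isQuasiOrthogonal_and_hasAtLeastZeros hkm
      (h.degree_bigQJacobi (p := k + m) (h.one_sub_α_div_ne_zero hα k) h.one_sub_γ_ne_zero
        (by rw [pow_add, mul_mul_mul_comm, div_mul_cancel₀ _ (hq _), div_mul_cancel₀ _ (hq _)])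
        hkm)
      (h.isQuasiOrthogonalFor_α hα hm k n hkm)
  refine ⟨fun hα k n hk => ?_, fun hβ m n hm => ?_, fun hβ l n hl => ?_,
    fun hα hβ k m n hkm => ?_⟩
  · simpa using h4 (m := 0) hα (fun n _ => by simpa using h.isQuasiOrthogonalFor_zero n) k n hk
  · exact h.isQuasiOrthogonal_and_hasAtLeastZeros hm
      (h.degree_bigQJacobi (p := m) h.one_sub_α_ne_zero h.one_sub_γ_ne_zero
        (by rw [mul_assoc, div_mul_cancel₀ _ (hq _)]) hm)
      (h.isQuasiOrthogonalFor_β (by linarith) m n hm)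
  · exact h.isQuasiOrthogonal_and_hasAtLeastZeros hl
      (h.degree_bigQJacobi (p := l) h.one_sub_α_ne_zero (h.one_sub_γ_div_ne_zero l)
        (by rw [mul_assoc, div_mul_cancel₀ _ (hq _)]) hl)
      (h.isQuasiOrthogonalFor_γ l n hl)
  · exact h4 hα (h.isQuasiOrthogonalFor_β (by linarith) m) k n hkm
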